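/- Let $N$ be a natural number, let $a_1>a_2>a_3$ be real numbers, and let $p_i,c_i,c'_i$ $(1\le i\le N)$ and $s$ be arbitrary real numbers. For $1\le i\le N$ put $$\eta_i(l,m,n,s)=p_is+\max(0,p_i-a_1)\,l+\max(0,p_i-a_2)\,m+\max(0,p_i-a_3)\,n+c_i,$$ $$\eta'_i(l,m,n,s)=-p_is+\max(0,-p_i-a_1)\,l+\max(0,-p_i-a_2)\,m+\max(0,-p_i-a_3)\,n+c'_i,$$ $$\phi_i(l,m,n,s)=\max\bigl(\eta_i(l,m,n,s),\eta'_i(l,m,n,s)\bigr).$$ For a real $N\times N$ matrix $(a_{ij})$ let $\max[a_{ij}]_{1\le i,j\le N}=\max_{\pi}\sum_{i=1}^N a_{i\pi_i}$ be its ultradiscrete permanent, where $\pi$ runs over all permutations of $\{1,\dots,N\}$. Then the tau function $$\tau(l,m,n)=\max[\phi_i(l,m,n,s+j-1)]_{1\le i,j\le N}$$ satisfies the ultradiscrete KP equation $$\tau(l,m+1,n)+\tau(l+1,m,n+1)-a_2=\max\bigl(\tau(l+1,m,n)+\tau(l,m+1,n+1)-a_1,\ \tau(l,m,n+1)+\tau(l+1,m+1,n)-a_2\bigr)$$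 for all real $l,m,n$ (in particular for all integers $l,m,n$). -/

import Mathlib

namespace UltradiscreteKP

/-- The ultradiscrete permanent of a real `N × N` matrix: the maximum over all permutations `π`
of `∑ i, A i (π i)`. -/
noncomputable def ultraPermanent {N : ℕ} (A : Matrix (Fin N) (Fin N) ℝ) : ℝ :=
  (Finset.univ : Finset (Equiv.Perm (Fin N))).sup' Finset.univ_nonempty
    (fun π => ∑ i, A i (π i))

/-- The piecewise-linear phase with slope `p` and constant `c`. -/
noncomputable def eta (a₁ a₂ a₃ p c l m n s : ℝ) : ℝ :=
  p * s + max 0 (p - a₁) * l + max 0 (p - a₂) * m + max 0 (p - a₃) * n + c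

/-- The companion phase, with slope `-p` and constant `c'`. -/
noncomputable def eta' (a₁ a₂ a₃ p c' l m n s : ℝ) : ℝ :=
  -p * s + max 0 (-p - a₁) * l + max 0 (-p - a₂) * m + max 0 (-p - a₃) * n + c'

/-- The entry function `φ`, the maximum of the two phases. -/
noncomputable def phi (a₁ a₂ a₃ p c c' l m n s : ℝ) : ℝ :=
  max (eta a₁ a₂ a₃ p c l m n s) (eta' a₁ a₂ a₃ p c' l m n s)

/-- The tau function: the ultradiscrete permanent of the matrix `φ_i(l, m, n, s + j - 1)`,
`1 ≤ i, j ≤ N`. Here `j : Fin N` starts from `0`, so the shift is `s + j`. -/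
noncomputable def tau {N : ℕ} (a₁ a₂ a₃ : ℝ) (p c c' : Fin N → ℝ) (s l m n : ℝ) : ℝ :=
  ultraPermanent (Matrix.of fun i j : Fin N =>
    phi a₁ a₂ a₃ (p i) (c i) (c' i) l m n (s + (j : ℕ)))

/-- The ultradiscrete KP equation for a function `τ(l, m, n)`. -/
def SatisfiesUKP (a₁ a₂ : ℝ) (τ : ℝ → ℝ → ℝ → ℝ) : Prop :=
  ∀ l m n : ℝ,
    τ l (m + 1) n + τ (l + 1) m (n + 1) - a₂ =
      max (τ (l + 1) m n + τ l (m + 1) (n + 1) - a₁)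
        (τ l m (n + 1) + τ (l + 1) (m + 1) n - a₂)

end UltradiscreteKP

/-!
For a fixed choice of one linear branch in every row, the ultradiscrete permanent is evaluated by
the rearrangement inequality. With `q i = ± p i` the chosen slopes, the tau function is the maximum
over all sign vectors of the constant terms plus `∑ i < j, max (q i) (q j)` (`tau_eq_signMax`).
Since `max 0 (q - a) = max q a - a`, raising a lattice variable by one adds a further point `a` to
the family of slopes. With an auxiliary point `a₀` above all others, the ultradiscrete KP equation
becomes a symmetric three-term relation for the maxima `G x y` of families enlarged by two points:
`G a₀ a₂ + G a₁ a₃ = max (G a₀ a₁ + G a₂ a₃) (G a₀ a₃ + G a₁ a₂)` (`pairMax_three_term`).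

Each side is a maximum over divisions of one multiset of points into two families, where the two
entries of a row go to different families. By a layer-cake formula the sum of the pairwise maxima
in the two families is largest when, at each level, the numbers of points below that level differ
by at most one (`maxSum_add_le_of_balanced`). So every division only has to be compared with a
balanced division of the required type.

* For `G a₀ a₂ + G a₁ a₃`, the rows in which the two sign vectors differ are distributed alternately
  by decreasing `|p i|` (`exists_exchange_alternating`). This dominates both terms on the right.
* For the right-hand side, match the points adjacent in sorted order, and match the two entries of
  each row, `a₀` with `a₂`, and `a₁` with `a₃`. The union of two perfect matchings is bipartite, and
  a proper colouring is balanced because of the first matching; because of the second it is one of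
  the two divisions on the right (`exists_exchange_coloring`). So their maximum dominates the left.
-/

namespace UltradiscreteKP

open Finset

/-! ### Sums of pairwise maxima and balanced divisions -/

/-- The sum of `max x y` over all ordered pairs of points of the family `q`, diagonal included. -/
noncomputable def maxSum {ι : Type*} [Fintype ι] (q : ι → ℝ) : ℝ :=
  ∑ i, ∑ j, max (q i) (q j)

/-- The number of points of the family `q` strictly below `t`. -/
noncomputable def below {ι : Type*} [Fintype ι] (q : ι → ℝ) (t : ℝ) : ℤ :=
  ∑ i, if q i < t then 1 else 0

lemma below_mono {ι : Type*} [Fintype ι] (q : ι → ℝ) : Monotone (below q) := by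
  intro t u htu
  refine Finset.sum_le_sum fun i _ => ?_
  split_ifs with h h' <;> first | exact absurd (h.trans_le htu) h' | norm_num

lemma below_nonneg {ι : Type*} [Fintype ι] (q : ι → ℝ) (t : ℝ) : 0 ≤ below q t :=
  Finset.sum_nonneg fun i _ => by split_ifs <;> norm_num

lemma monotone_below_sq {ι : Type*} [Fintype ι] (q : ι → ℝ) :
    Monotone fun t => ((below q t : ℤ) : ℝ) ^ 2 := by
  intro t u htu
  have h0 : (0 : ℝ) ≤ (below q t : ℤ) := by exact_mod_cast below_nonneg q t
  have h1 : ((below q t : ℤ) : ℝ) ≤ (below q u : ℤ) := by exact_mod_cast below_mono q htu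
  exact pow_le_pow_left₀ h0 h1 2

lemma monotone_step (m : ℝ) : Monotone fun t : ℝ => if m < t then (1 : ℝ) else 0 := by
  intro t u htu
  dsimp only
  split_ifs with h1 h2 <;> first | exact absurd (h1.trans_le htu) h2 | norm_num

lemma integral_step {R m : ℝ} (h : -R ≤ m) (h' : m ≤ R) :
    ∫ t in (-R)..R, (if m < t then (1 : ℝ) else 0) = R - m := by
  rw [← intervalIntegral.integral_add_adjacent_intervals (b := m)
    (monotone_step m).intervalIntegrable (monotone_step m).intervalIntegrable]
  have e1 : ∫ t in (-R)..m, (if m < t then (1 : ℝ) else 0) = ∫ t in (-R)..m, (0 : ℝ) := by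
    refine intervalIntegral.integral_congr fun t ht => ?_
    rw [Set.uIcc_of_le h] at ht
    exact if_neg (not_lt.2 ht.2)
  have e2 : ∫ t in m..R, (if m < t then (1 : ℝ) else 0) = ∫ t in m..R, (1 : ℝ) := by
    refine intervalIntegral.integral_congr_ae (Filter.Eventually.of_forall fun t ht => ?_)
    rw [Set.uIoc_of_le h'] at ht
    exact if_pos ht.1
  rw [e1, e2]
  simp

/-- Layer-cake formula: on `[-R, R]`, `R - max x y` is the integral of `1_{x < t} * 1_{y < t}`, so
the sum of all pairwise maxima is a constant minus the integral of the squared counting function. -/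
lemma maxSum_eq_integral {ι : Type*} [Fintype ι] (q : ι → ℝ) {R : ℝ} (hR : ∀ i, |q i| ≤ R) :
    maxSum q = R * (Fintype.card ι : ℝ) ^ 2
      - ∫ t in (-R)..R, ((below q t : ℤ) : ℝ) ^ 2 := by
  have hsq : ∀ t, ((below q t : ℤ) : ℝ) ^ 2
      = ∑ i, ∑ j, if max (q i) (q j) < t then (1 : ℝ) else 0 := by
    intro t
    simp only [below, Int.cast_sum, sq, Finset.sum_mul_sum]
    refine Finset.sum_congr rfl fun i _ => Finset.sum_congr rfl fun j _ => ?_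
    by_cases h1 : q i < t <;> by_cases h2 : q j < t <;> simp [h1, h2]
  have hint : ∀ m : ℝ, IntervalIntegrable (fun t => if m < t then (1 : ℝ) else 0)
      MeasureTheory.volume (-R) R :=
    fun m => (monotone_step m).intervalIntegrable
  simp only [hsq]
  rw [intervalIntegral.integral_finsetSum]
  swap
  · intro i _
    have h := IntervalIntegrable.sum Finset.univ fun j _ => hint (max (q i) (q j))
    rw [Finset.sum_fn] at h
    exact h
  have : ∀ i, ∫ t in (-R)..R, (∑ j, if max (q i) (q j) < t then (1 : ℝ) else 0)
      = ∑ j, (R - max (q i) (q j)) := by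
    intro i
    rw [intervalIntegral.integral_finsetSum fun j _ => hint _]
    refine Finset.sum_congr rfl fun j _ => integral_step ?_ ?_
    · exact (abs_le.1 (hR i)).1.trans (le_max_left _ _)
    · exact max_le (abs_le.1 (hR i)).2 (abs_le.1 (hR j)).2
  simp only [this, maxSum, Finset.sum_sub_distrib, Finset.sum_const, Finset.card_univ,
    nsmul_eq_mul]
  ring

lemma sq_add_sq_le_of_balanced {a b c d : ℤ} (h : a + b = c + d) (hcd : |c - d| ≤ 1) :
    c ^ 2 + d ^ 2 ≤ a ^ 2 + b ^ 2 := by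
  have key : (c - d) ^ 2 ≤ (a - b) ^ 2 := by
    rcases eq_or_ne (a - b) 0 with h0 | h0
    · have : c - d = 0 := by rw [abs_le] at hcd; omega
      rw [this, h0]
    · exact sq_le_sq.2 (hcd.trans (Int.one_le_abs h0))
  have h2 : (a + b) ^ 2 = (c + d) ^ 2 := by rw [h]
  linarith [key, h2, (by ring : (a - b) ^ 2 + (a + b) ^ 2 = 2 * (a ^ 2 + b ^ 2)),
    (by ring : (c - d) ^ 2 + (c + d) ^ 2 = 2 * (c ^ 2 + d ^ 2))]

/-- Among the ways of dividing a fixed multiset of points into two families of the same size, the sum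
of the two `maxSum`s is largest when the counting functions never differ by more than one: two
integers with a given sum have the least sum of squares when they are as equal as possible. -/
lemma maxSum_add_le_of_balanced {ι : Type*} [Fintype ι] {q q' r r' : ι → ℝ}
    (hadd : ∀ t, below q t + below q' t = below r t + below r' t)
    (hbal : ∀ t, |below r t - below r' t| ≤ 1) :
    maxSum q + maxSum q' ≤ maxSum r + maxSum r' := by
  set R : ℝ := (∑ i, |q i|) + (∑ i, |q' i|) + (∑ i, |r i|) + ∑ i, |r' i| with hR
  have hs : ∀ f : ι → ℝ, 0 ≤ ∑ i, |f i| := fun f => Finset.sum_nonneg fun i _ => abs_nonneg _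
  have hi : ∀ (f : ι → ℝ) i, |f i| ≤ ∑ i, |f i| := fun f i =>
    Finset.single_le_sum (f := fun i => |f i|) (fun i _ => abs_nonneg _) (Finset.mem_univ i)
  have := hs q; have := hs q'; have := hs r; have := hs r'
  have hint : ∀ f : ι → ℝ, IntervalIntegrable (fun t => ((below f t : ℤ) : ℝ) ^ 2)
      MeasureTheory.volume (-R) R := fun f => (monotone_below_sq f).intervalIntegrable
  rw [maxSum_eq_integral q (R := R) fun i => by linarith [hi q i],
    maxSum_eq_integral q' (R := R) fun i => by linarith [hi q' i],
    maxSum_eq_integral r (R := R) fun i => by linarith [hi r i],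
    maxSum_eq_integral r' (R := R) fun i => by linarith [hi r' i]]
  have key : (∫ t in (-R)..R, (((below r t : ℤ) : ℝ) ^ 2 + ((below r' t : ℤ) : ℝ) ^ 2))
      ≤ ∫ t in (-R)..R, (((below q t : ℤ) : ℝ) ^ 2 + ((below q' t : ℤ) : ℝ) ^ 2) := by
    refine intervalIntegral.integral_mono (by linarith) ((hint _).add (hint _))
      ((hint _).add (hint _)) fun t => ?_
    have h := sq_add_sq_le_of_balanced (hadd t) (hbal t)
    dsimp only
    exact_mod_cast h
  rw [intervalIntegral.integral_add (hint _) (hint _),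
    intervalIntegral.integral_add (hint _) (hint _)] at key
  linarith

/-! ### Alternating signs -/

/-- Signs alternating along decreasing `f`: every subset of `D` that is upward closed for `f` has sign
sum `0` or `1`. -/
lemma exists_alternating {ι : Type*} [DecidableEq ι] (f : ι → ℝ) (D : Finset ι) :
    ∃ s : ι → ℤ, (∀ i, s i = 1 ∨ s i = -1) ∧
      ∀ U ⊆ D, (∀ i ∈ U, ∀ j ∈ D, f i ≤ f j → j ∈ U) → ∑ i ∈ U, s i = 0 ∨ ∑ i ∈ U, s i = 1 := by
  induction D using Finset.induction_on_min_value f with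
  | empty =>
    refine ⟨fun _ => 1, fun _ => Or.inl rfl, fun U hU _ => Or.inl ?_⟩
    rw [Finset.subset_empty.1 hU, Finset.sum_empty]
  | insert a D ha hmin ih =>
    obtain ⟨s, hs, hsum⟩ := ih
    have hD := hsum D subset_rfl fun i _ j hj _ => hj
    have hupd : ∀ c : ℤ, ∀ U ⊆ D, ∑ i ∈ U, Function.update s a c i = ∑ i ∈ U, s i := by
      intro c U hU
      refine Finset.sum_congr rfl fun i hi => Function.update_of_ne ?_ _ _
      rintro rfl
      exact ha (hU hi)
    -- The new element has the least value, so it belongs only to the upward closed set `insert a D`.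
    refine ⟨Function.update s a (if ∑ i ∈ D, s i = 0 then 1 else -1), fun i => ?_, ?_⟩
    · rcases eq_or_ne i a with rfl | hi
      · rw [Function.update_self]
        split_ifs <;> simp
      · rw [Function.update_of_ne hi]
        exact hs i
    · intro U hU hup
      by_cases haU : a ∈ U
      · have : U = insert a D := by
          refine Finset.Subset.antisymm hU (Finset.insert_subset haU fun j hj => ?_)
          exact hup a haU j (Finset.mem_insert_of_mem hj) (hmin j hj)
        rw [this, Finset.sum_insert ha, Function.update_self, hupd _ _ subset_rfl]
        rcases hD with h | h <;> simp [h]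
      · have hUD : U ⊆ D := fun i hi =>
          (Finset.mem_insert.1 (hU hi)).resolve_left fun h => haU (h ▸ hi)
        rw [hupd _ U hUD]
        exact hsum U hUD fun i hi j hj => hup i hi j (Finset.mem_insert_of_mem hj)

/-! ### Balanced colourings -/

/-- Two fixed-point-free involutions have a common proper colouring by `±1`: the graph formed by
their orbits is a disjoint union of even cycles and two-sided infinite paths. -/
lemma exists_coloring_of_involutions {X : Type*} (c d : Equiv.Perm X)
    (hc : ∀ x, c (c x) = x) (hd : ∀ x, d (d x) = x) (hcx : ∀ x, c x ≠ x) (hdx : ∀ x, d x ≠ x) :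
    ∃ w : X → ℤ, (∀ x, w x = 1 ∨ w x = -1) ∧ (∀ x, w (c x) = -w x) ∧ ∀ x, w (d x) = -w x := by
  have hcc : c * c = 1 := Equiv.ext hc
  have hdd : d * d = 1 := Equiv.ext hd
  set ρ : Equiv.Perm X := c * d with hρ
  have hinv : c⁻¹ = c := inv_eq_of_mul_eq_one_left hcc
  have hdinv : d⁻¹ = d := inv_eq_of_mul_eq_one_left hdd
  have hconj : c * ρ * c⁻¹ = ρ⁻¹ := by
    rw [hρ, mul_inv_rev, hinv, hdinv, ← mul_assoc c c d, hcc, one_mul]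
  have hcz : ∀ (k : ℤ) x, c ((ρ ^ k) x) = (ρ ^ (-k)) (c x) := by
    intro k x
    have : c * ρ ^ k = ρ ^ (-k) * c := by
      rw [← mul_inv_eq_iff_eq_mul, ← conj_zpow, hconj, inv_zpow, zpow_neg]
    exact congrArg (fun g : Equiv.Perm X => g x) this
  have hdρ : ∀ x, d x = c (ρ x) := fun x => (hc (d x)).symm
  -- The involution `c` conjugates `ρ` to its inverse, so a power of `ρ` taking `x` to `c x` would
  -- produce, halfway along, a fixed point of `c` (even power) or of `d` (odd power).
  have hne : ∀ x, ¬ ρ.SameCycle x (c x) := by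
    rintro x ⟨k, hk⟩
    rcases Int.even_or_odd' k with ⟨j, rfl | rfl⟩
    · refine hcx ((ρ ^ j) x) ?_
      rw [hcz, ← hk, ← Equiv.Perm.mul_apply, ← zpow_add]
      congr 2
      ring
    · refine hdx ((ρ ^ j) x) ?_
      rw [hdρ, ← Equiv.Perm.mul_apply ρ, ← zpow_one_add, hcz, ← hk, ← Equiv.Perm.mul_apply,
        ← zpow_add]
      congr 2
      ring
  have hcs : ∀ x y, ρ.SameCycle x y → ρ.SameCycle (c x) (c y) := by
    rintro x y ⟨k, rfl⟩
    exact ⟨-k, (hcz k x).symm⟩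
  let S : Setoid X := Equiv.Perm.SameCycle.setoid ρ
  let o : X → Quotient S := Quotient.mk S
  have ho : ∀ x y, o x = o y ↔ ρ.SameCycle x y := fun x y => Quotient.eq
  have hρs : ∀ x, ρ.SameCycle (ρ x) x := fun x => ⟨-1, by simp⟩
  have hod : ∀ x, o (d x) = o (c x) := fun x => by
    rw [hdρ, ho]; exact hcs _ _ (hρs x)
  have hocd : ∀ x, o (c (d x)) = o x := fun x => (ho _ _).2 (hρs x)
  classical
  -- On the set of `ρ`-cycles, `c` and `d` induce the same fixed-point-free involution; a cycle is
  -- coloured by comparing it with its partner in an arbitrary well-order.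
  have hflip : ∀ x, (if WellOrderingRel (o (c x)) (o x) then (1 : ℤ) else -1)
      = -(if WellOrderingRel (o x) (o (c x)) then (1 : ℤ) else -1) := by
    intro x
    rcases trichotomous_of WellOrderingRel (o x) (o (c x)) with h | h | h
    · rw [if_pos h, if_neg (asymm_of WellOrderingRel h)]
    · exact absurd ((ho _ _).1 h) (hne x)
    · rw [if_pos h, if_neg (asymm_of WellOrderingRel h)]; rfl
  refine ⟨fun x => if WellOrderingRel (o x) (o (c x)) then 1 else -1, fun x => ?_, fun x => ?_,
    fun x => ?_⟩
  · dsimp only; split_ifs <;> simp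
  · dsimp only; rw [hc]; exact hflip x
  · dsimp only; rw [hod, hocd]; exact hflip x

/-- Pairing the points of an even family with their neighbours in sorted order gives an involution `c`
such that every sign choice opposite on each pair has all its partial sums in `{-1, 0, 1}`. -/
lemma exists_adjacent_pairing {X : Type*} [Fintype X] (hX : Even (Fintype.card X)) (v : X → ℝ) :
    ∃ c : Equiv.Perm X, (∀ x, c (c x) = x) ∧ (∀ x, c x ≠ x) ∧
      ∀ w : X → ℤ, (∀ x, w x = 1 ∨ w x = -1) → (∀ x, w (c x) = -w x) →
        ∀ t, |∑ x, if v x < t then w x else 0| ≤ 1 := by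
  obtain ⟨k, hk⟩ := hX
  have e₀ : Fin (k * 2) ≃ X := (Fintype.equivFinOfCardEq (by rw [hk]; ring)).symm
  set e₁ : Fin (k * 2) ≃ X := (Tuple.sort (v ∘ e₀)).trans e₀ with he₁
  have hmono : Monotone (v ∘ e₁) := Tuple.monotone_sort (v ∘ e₀)
  set e : Fin k × Fin 2 ≃ X := finProdFinEquiv.trans e₁ with he
  have hle : ∀ a b : Fin k × Fin 2,
      (a.2 : ℕ) + 2 * a.1 ≤ (b.2 : ℕ) + 2 * b.1 → v (e a) ≤ v (e b) := by
    intro a b hab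
    refine hmono ?_
    rw [Fin.le_def]
    simpa [finProdFinEquiv] using hab
  have hrev : ∀ b : Fin 2, Fin.rev b ≠ b := by decide
  let flip : Equiv.Perm (Fin k × Fin 2) := Equiv.prodCongr (Equiv.refl _) Fin.revPerm
  refine ⟨(e.symm.trans flip).trans e, fun x => by simp [flip, Prod.map], fun x hx => ?_, ?_⟩
  · have h1 : flip (e.symm x) = e.symm x := by
      apply e.injective
      simpa using hx
    exact hrev _ (congrArg Prod.snd h1)
  · intro w hw hwc t
    have hw1 : ∀ j, w (e (j, 1)) = -w (e (j, 0)) := by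
      intro j
      have := hwc (e (j, 0))
      simpa [flip] using this
    rw [← e.sum_comp, Fintype.sum_prod_type]
    simp only [Fin.sum_univ_two, hw1]
    set g : Fin k → ℤ := fun j => (if v (e (j, 0)) < t then w (e (j, 0)) else 0)
      + (if v (e (j, 1)) < t then -w (e (j, 0)) else 0) with hg
    -- A pair contributes only when `t` separates its two points, which happens for at most one pair.
    have hg0 : ∀ j, g j ≠ 0 → v (e (j, 0)) < t ∧ t ≤ v (e (j, 1)) := by
      intro j hj
      have h01 := hle (j, 0) (j, 1) (by simp)
      by_cases h1 : v (e (j, 1)) < t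
      · exact absurd (by simp [hg, h1, h01.trans_lt h1]) hj
      · refine ⟨?_, not_lt.1 h1⟩
        by_contra h0
        exact hj (by simp [hg, h1, h0])
    have hg1 : ∀ j, |g j| ≤ 1 := by
      intro j
      simp only [hg]
      rcases hw (e (j, 0)) with h | h <;> rw [h] <;> split_ifs <;> norm_num
    by_cases hex : ∃ j, g j ≠ 0
    · obtain ⟨j, hj⟩ := hex
      rw [Finset.sum_eq_single j]
      · exact hg1 j
      · intro i _ hij
        by_contra hi
        obtain ⟨hi0, hi1⟩ := hg0 i hi
        obtain ⟨hj0, hj1⟩ := hg0 j hj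
        rcases lt_or_gt_of_ne hij with h | h
        · have := hle (i, 1) (j, 0) (by simp; omega)
          linarith
        · have := hle (j, 1) (i, 0) (by simp; omega)
          linarith
      · simp
    · push Not at hex
      simp [hex]

/-- For an involution `d` without fixed points there is a sign choice, opposite on the orbits of `d`,
whose partial sums in the order of `v` all lie in `{-1, 0, 1}`. -/
lemma exists_balanced_coloring {X : Type*} [Fintype X] (v : X → ℝ) (d : Equiv.Perm X)
    (hd : ∀ x, d (d x) = x) (hdx : ∀ x, d x ≠ x) (hX : Even (Fintype.card X)) (x₀ : X) :
    ∃ w : X → ℤ, (∀ x, w x = 1 ∨ w x = -1) ∧ (∀ x, w (d x) = -w x) ∧ w x₀ = 1 ∧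
      ∀ t, |∑ x, if v x < t then w x else 0| ≤ 1 := by
  obtain ⟨c, hc, hcx, hbal⟩ := exists_adjacent_pairing hX v
  obtain ⟨w, hw, hwc, hwd⟩ := exists_coloring_of_involutions c d hc hd hcx hdx
  rcases hw x₀ with h | h
  · exact ⟨w, hw, hwd, h, hbal w hw hwc⟩
  · have hw' : ∀ x, -w x = 1 ∨ -w x = -1 := fun x => by rcases hw x with h | h <;> simp [h]
    exact ⟨fun x => -w x, hw', fun x => by simp [hwd], by simp [h],
      hbal _ hw' fun x => by simp [hwc]⟩

/-! ### The tau function as a maximum over sign vectors -/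

/-- The slope `p` or `-p`, the sign being given by a Boolean (`true` for `+`). -/
noncomputable def signed (p : ℝ) (b : Bool) : ℝ := if b then p else -p

/-- With columns counted from `0`, `π i` is the number of `j` with `π j < π i`; hence the sum splits
over pairs, each pair contributing the value at its later element. -/
lemma mul_perm_sum_eq {N : ℕ} (q : Fin N → ℝ) (π : Equiv.Perm (Fin N)) :
    2 * ∑ i, q i * ((π i : ℕ) : ℝ)
      = ∑ i, ∑ j, ((if π j < π i then q i else 0) + if π i < π j then q j else 0) := by
  have hval : ∀ i, q i * ((π i : ℕ) : ℝ) = ∑ j, if π j < π i then q i else 0 := by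
    intro i
    rw [Equiv.sum_comp π fun k => if k < π i then q i else 0, ← Finset.sum_filter,
      Finset.sum_const, nsmul_eq_mul, Finset.filter_gt_eq_Iio, Fin.card_Iio, mul_comm]
  have h2 : ∑ i, ∑ j, (if π i < π j then q j else 0) = ∑ i, q i * ((π i : ℕ) : ℝ) := by
    rw [Finset.sum_comm]
    exact Finset.sum_congr rfl fun i _ => (hval i).symm
  simp only [Finset.sum_add_distrib]
  rw [h2, Finset.sum_congr rfl fun i _ => hval i]
  ring

lemma maxSum_sub_sum_eq {N : ℕ} (q : Fin N → ℝ) :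
    maxSum q - ∑ i, q i = ∑ i, ∑ j, if i = j then 0 else max (q i) (q j) := by
  rw [maxSum, ← Finset.sum_sub_distrib]
  refine Finset.sum_congr rfl fun i _ => ?_
  have : q i = ∑ j, if i = j then q i else 0 := by simp
  conv_lhs => rw [this]
  rw [← Finset.sum_sub_distrib]
  refine Finset.sum_congr rfl fun j _ => ?_
  rcases eq_or_ne i j with rfl | h
  · simp
  · simp [h]

lemma mul_perm_sum_le {N : ℕ} (q : Fin N → ℝ) (π : Equiv.Perm (Fin N)) :
    ∑ i, q i * ((π i : ℕ) : ℝ) ≤ (maxSum q - ∑ i, q i) / 2 := by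
  rw [le_div_iff₀ two_pos, mul_comm, mul_perm_sum_eq, maxSum_sub_sum_eq]
  refine Finset.sum_le_sum fun i _ => Finset.sum_le_sum fun j _ => ?_
  rcases eq_or_ne i j with rfl | h
  · simp
  · rcases lt_or_gt_of_ne (π.injective.ne h) with h' | h' <;> simp [h, h', h'.not_gt]

lemma exists_mul_perm_sum_eq {N : ℕ} (q : Fin N → ℝ) :
    ∃ π : Equiv.Perm (Fin N), ∑ i, q i * ((π i : ℕ) : ℝ) = (maxSum q - ∑ i, q i) / 2 := by
  have hle : ∀ i j, (Tuple.sort q).symm i < (Tuple.sort q).symm j → q i ≤ q j := by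
    intro i j h
    simpa using Tuple.monotone_sort q h.le
  refine ⟨(Tuple.sort q).symm, ?_⟩
  rw [eq_div_iff two_ne_zero, mul_comm, mul_perm_sum_eq, maxSum_sub_sum_eq]
  refine Finset.sum_congr rfl fun i _ => Finset.sum_congr rfl fun j _ => ?_
  rcases eq_or_ne i j with rfl | h
  · simp
  · rcases lt_or_gt_of_ne ((Tuple.sort q).symm.injective.ne h) with h' | h'
    · simp [h, h', h'.not_gt, hle _ _ h']
    · simp [h, h', h'.not_gt, hle _ _ h']

/-- The value of the permanent when row `i` is replaced by its linear branch of sign `σ i` and constant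
term `θ i (σ i)`; the second summand is the sum of `max` over unordered pairs of distinct rows. -/
noncomputable def signEnergy {N : ℕ} (p : Fin N → ℝ) (θ : Fin N → Bool → ℝ)
    (σ : Fin N → Bool) : ℝ :=
  ∑ i, θ i (σ i)
    + (maxSum (fun i => signed (p i) (σ i)) - ∑ i, signed (p i) (σ i)) / 2

/-- The maximum of `signEnergy` over all sign vectors. -/
noncomputable def signMax {N : ℕ} (p : Fin N → ℝ) (θ : Fin N → Bool → ℝ) : ℝ :=
  (Finset.univ : Finset (Fin N → Bool)).sup' Finset.univ_nonempty (signEnergy p θ)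

/-- The phases `eta` and `eta'` as one family indexed by a sign. -/
noncomputable def phase (a₁ a₂ a₃ p c c' l m n s : ℝ) (b : Bool) : ℝ :=
  if b then eta a₁ a₂ a₃ p c l m n s else eta' a₁ a₂ a₃ p c' l m n s

lemma phi_add_eq (a₁ a₂ a₃ p c c' l m n s x : ℝ) :
    phi a₁ a₂ a₃ p c c' l m n (s + x)
      = max (phase a₁ a₂ a₃ p c c' l m n s true + signed p true * x)
        (phase a₁ a₂ a₃ p c c' l m n s false + signed p false * x) := by
  simp only [phi, phase, signed, eta, eta', if_true, Bool.false_eq_true, if_false]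
  congr 1 <;> ring

/-- The tau function as a maximum over the `2 ^ N` sign vectors: for fixed signs, the maximum over
permutations is given by the rearrangement inequality. -/
lemma tau_eq_signMax {N : ℕ} (a₁ a₂ a₃ : ℝ) (p c c' : Fin N → ℝ) (s l m n : ℝ) :
    tau a₁ a₂ a₃ p c c' s l m n
      = signMax p fun i => phase a₁ a₂ a₃ (p i) (c i) (c' i) l m n s := by
  set θ : Fin N → Bool → ℝ := fun i => phase a₁ a₂ a₃ (p i) (c i) (c' i) l m n s with hθ
  have hφ : ∀ i x, phi a₁ a₂ a₃ (p i) (c i) (c' i) l m n (s + x)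
      = max (θ i true + signed (p i) true * x) (θ i false + signed (p i) false * x) :=
    fun i x => phi_add_eq ..
  simp only [tau, ultraPermanent, Matrix.of_apply, hφ]
  apply le_antisymm
  · refine Finset.sup'_le _ _ fun π _ => ?_
    have hσ : ∀ i, ∃ b, max (θ i true + signed (p i) true * ((π i : ℕ) : ℝ))
        (θ i false + signed (p i) false * ((π i : ℕ) : ℝ))
          = θ i b + signed (p i) b * ((π i : ℕ) : ℝ) := by
      intro i
      rcases max_choice (θ i true + signed (p i) true * ((π i : ℕ) : ℝ))
        (θ i false + signed (p i) false * ((π i : ℕ) : ℝ)) with h | h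
      · exact ⟨true, h⟩
      · exact ⟨false, h⟩
    choose σ hσ using hσ
    refine le_trans ?_ (Finset.le_sup' (signEnergy p θ) (Finset.mem_univ σ))
    rw [Finset.sum_congr rfl fun i _ => hσ i, Finset.sum_add_distrib, signEnergy]
    gcongr
    exact mul_perm_sum_le (fun i => signed (p i) (σ i)) π
  · refine Finset.sup'_le _ _ fun σ _ => ?_
    obtain ⟨π, hπ⟩ := exists_mul_perm_sum_eq fun i => signed (p i) (σ i)
    refine le_trans ?_ (Finset.le_sup' _ (Finset.mem_univ π))
    rw [signEnergy, ← hπ, ← Finset.sum_add_distrib]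
    refine Finset.sum_le_sum fun i _ => ?_
    cases σ i
    · exact le_max_right _ _
    · exact le_max_left _ _

/-! ### Families with two additional points -/

/-- The signed slopes of all rows, together with two further points `α` and `β`. -/
noncomputable def points {N : ℕ} (p : Fin N → ℝ) (σ : Fin N → Bool) (α β : ℝ) :
    Fin N ⊕ Fin 2 → ℝ :=
  Sum.elim (fun i => signed (p i) (σ i)) ![α, β]

lemma below_points {N : ℕ} (p : Fin N → ℝ) (σ : Fin N → Bool) (α β t : ℝ) :
    below (points p σ α β) t
      = (∑ i, if signed (p i) (σ i) < t then 1 else 0)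
        + ((if α < t then 1 else 0) + if β < t then 1 else 0) := by
  simp only [below, points, Fintype.sum_sum_type, Sum.elim_inl, Sum.elim_inr, Fin.sum_univ_two,
    Matrix.cons_val_zero, Matrix.cons_val_one]
  rfl

lemma maxSum_points {N : ℕ} (p : Fin N → ℝ) (σ : Fin N → Bool) (α β : ℝ) :
    maxSum (points p σ α β)
      = maxSum (fun i => signed (p i) (σ i)) + 2 * ∑ i, max (signed (p i) (σ i)) α
        + 2 * ∑ i, max (signed (p i) (σ i)) β + 2 * max α β + α + β := by
  simp only [maxSum, points, Fintype.sum_sum_type, Sum.elim_inl, Sum.elim_inr, Fin.sum_univ_two,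
    Matrix.cons_val_zero, Matrix.cons_val_one, Finset.sum_add_distrib, max_self, max_comm α,
    max_comm β (signed _ _)]
  ring

/-- Twice the sign energy of the rows enlarged by two linear rows of slopes `α` and `β`, up to the
summand `α + β` coming from the diagonal of `maxSum`. A shift of a lattice variable of the tau
function has the effect of such an additional row. -/
noncomputable def pairEnergy {N : ℕ} (p : Fin N → ℝ) (θ : Fin N → Bool → ℝ) (α β : ℝ)
    (σ : Fin N → Bool) : ℝ :=
  2 * ∑ i, θ i (σ i) - ∑ i, signed (p i) (σ i) + maxSum (points p σ α β)

/-- The maximum of `pairEnergy` over all sign vectors. -/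
noncomputable def pairMax {N : ℕ} (p : Fin N → ℝ) (θ : Fin N → Bool → ℝ) (α β : ℝ) : ℝ :=
  (Finset.univ : Finset (Fin N → Bool)).sup' Finset.univ_nonempty (pairEnergy p θ α β)

lemma pairMax_eq_signMax {N : ℕ} (p : Fin N → ℝ) {θ θ' : Fin N → Bool → ℝ} {α β : ℝ}
    (h : ∀ i b, θ' i b = θ i b + (max (signed (p i) b) α - α) + (max (signed (p i) b) β - β)) :
    pairMax p θ α β = 2 * signMax p θ' + (2 * N * (α + β) + 2 * max α β + α + β) := by
  have hE : ∀ σ, pairEnergy p θ α β σ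
      = 2 * signEnergy p θ' σ + (2 * N * (α + β) + 2 * max α β + α + β) := by
    intro σ
    simp only [pairEnergy, signEnergy, maxSum_points, h, Finset.sum_add_distrib,
      Finset.sum_sub_distrib, Finset.sum_const, Finset.card_univ, Fintype.card_fin, nsmul_eq_mul]
    ring
  apply le_antisymm
  · refine Finset.sup'_le _ _ fun σ _ => ?_
    rw [hE]
    have := Finset.le_sup' (signEnergy p θ') (Finset.mem_univ σ)
    rw [signMax]
    linarith
  · obtain ⟨σ, hσ, hmax⟩ := Finset.exists_mem_eq_sup' Finset.univ_nonempty (signEnergy p θ')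
    rw [signMax, hmax, ← hE]
    exact Finset.le_sup' (pairEnergy p θ α β) hσ

/-- The pair `(τ, τ')` of sign vectors arises from `(σ, σ')` by exchanging the two entries in some of
the positions. -/
def IsExchange {N : ℕ} (σ σ' τ τ' : Fin N → Bool) : Prop :=
  ∀ i, (τ i = σ i ∧ τ' i = σ' i) ∨ (τ i = σ' i ∧ τ' i = σ i)

lemma IsExchange.sum_add_sum {N : ℕ} {M : Type*} [AddCommMonoid M] {σ σ' τ τ' : Fin N → Bool}
    (h : IsExchange σ σ' τ τ') (f : Fin N → Bool → M) :
    ∑ i, f i (σ i) + ∑ i, f i (σ' i) = ∑ i, f i (τ i) + ∑ i, f i (τ' i) := by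
  rw [← Finset.sum_add_distrib, ← Finset.sum_add_distrib]
  refine Finset.sum_congr rfl fun i _ => ?_
  rcases h i with ⟨h1, h2⟩ | ⟨h1, h2⟩ <;> rw [h1, h2]
  exact add_comm _ _

/-! ### The three-term relation -/

/-- An upper bound for `pairMax p θ α β + pairMax p θ α' β'`: it suffices that any two sign vectors
can be rearranged, together with the points `α, β, α', β'`, into a balanced division of a type
whose maximum is at most `M`. -/
lemma pairMax_add_le {N : ℕ} (p : Fin N → ℝ) (θ : Fin N → Bool → ℝ) {α β α' β' M : ℝ}
    (h : ∀ σ σ' : Fin N → Bool, ∃ γ ε γ' ε' : ℝ, ∃ τ τ' : Fin N → Bool,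
      IsExchange σ σ' τ τ' ∧ pairMax p θ γ ε + pairMax p θ γ' ε' ≤ M ∧
      (∀ t : ℝ, (((if α < t then 1 else 0) + if β < t then 1 else 0)
          + ((if α' < t then 1 else 0) + if β' < t then 1 else 0) : ℤ)
        = ((if γ < t then 1 else 0) + if ε < t then 1 else 0)
          + ((if γ' < t then 1 else 0) + if ε' < t then 1 else 0)) ∧
      ∀ t, |below (points p τ γ ε) t - below (points p τ' γ' ε') t| ≤ 1) :
    pairMax p θ α β + pairMax p θ α' β' ≤ M := by
  obtain ⟨σ, -, hσ⟩ := Finset.exists_mem_eq_sup' Finset.univ_nonempty (pairEnergy p θ α β)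
  obtain ⟨σ', -, hσ'⟩ := Finset.exists_mem_eq_sup' Finset.univ_nonempty (pairEnergy p θ α' β')
  obtain ⟨γ, ε, γ', ε', τ, τ', hex, hM, hadd, hbal⟩ := h σ σ'
  refine le_trans ?_ hM
  have h1 : pairEnergy p θ γ ε τ ≤ pairMax p θ γ ε :=
    Finset.le_sup' (pairEnergy p θ γ ε) (Finset.mem_univ τ)
  have h2 : pairEnergy p θ γ' ε' τ' ≤ pairMax p θ γ' ε' :=
    Finset.le_sup' (pairEnergy p θ γ' ε') (Finset.mem_univ τ')
  refine le_trans ?_ (add_le_add h1 h2)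
  have h3 := hex.sum_add_sum θ
  have h4 := hex.sum_add_sum fun i => signed (p i)
  have h5 := maxSum_add_le_of_balanced (q := points p σ α β) (q' := points p σ' α' β')
    (fun t => by
      have h6 := hex.sum_add_sum fun i b => if signed (p i) b < t then (1 : ℤ) else 0
      have h7 := hadd t
      simp only [below_points] at h6 ⊢
      linarith) hbal
  rw [pairMax, pairMax, hσ, hσ']
  simp only [pairEnergy]
  linarith

/-- If the four additional points are divided alternately, every pair of sign vectors can be balanced:
the rows in which they differ are oriented alternately in the order of `|p i|`. -/
lemma exists_exchange_alternating {N : ℕ} (p : Fin N → ℝ) {x₀ x₁ x₂ x₃ : ℝ} (h₁₀ : x₁ ≤ x₀)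
    (h₂₁ : x₂ ≤ x₁) (h₃₂ : x₃ ≤ x₂) (σ σ' : Fin N → Bool) :
    ∃ τ τ' : Fin N → Bool, IsExchange σ σ' τ τ' ∧
      ∀ t, |below (points p τ x₀ x₂) t - below (points p τ' x₁ x₃) t| ≤ 1 := by
  classical
  obtain ⟨w, hw, hsum⟩ :=
    exists_alternating (fun i => |p i|) (Finset.univ.filter fun i => σ i ≠ σ' i)
  -- The entry with slope `-|p i|` goes to the first vector when `w i = 1`, to the second otherwise.
  let b : Fin N → Prop := fun i => (w i = 1 ↔ signed (p i) (σ i) ≤ signed (p i) (σ' i))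
  refine ⟨fun i => if b i then σ i else σ' i, fun i => if b i then σ' i else σ i, fun i => ?_,
    fun t => ?_⟩
  · by_cases h : b i <;> simp [h]
  -- Row `i` contributes `w i` exactly for `-|p i| < t ≤ |p i|`, a condition that is upward closed in
  -- `|p i|`. The rows thus contribute `0` or `1`, and the four additional points `0` or `-1`.
  · have hterm : ∀ i,
        ((if signed (p i) (if b i then σ i else σ' i) < t then 1 else 0)
          - (if signed (p i) (if b i then σ' i else σ i) < t then 1 else 0) : ℤ)
        = if σ i ≠ σ' i ∧ -|p i| < t ∧ t ≤ |p i| then w i else 0 := by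
      intro i
      by_cases hσ : σ i = σ' i
      · simp [hσ]
      have hslope : (signed (p i) (σ i) = -|p i| ∧ signed (p i) (σ' i) = |p i|) ∨
          (signed (p i) (σ i) = |p i| ∧ signed (p i) (σ' i) = -|p i|) := by
        rcases abs_choice (p i) with h | h <;> rw [h] <;> cases h1 : σ i <;> cases h2 : σ' i <;>
          simp_all [signed]
      have habs : -|p i| ≤ |p i| := neg_le_self (abs_nonneg _)
      have hor : (w i = 1 ∧ signed (p i) (if b i then σ i else σ' i) = -|p i| ∧
            signed (p i) (if b i then σ' i else σ i) = |p i|) ∨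
          (w i = -1 ∧ signed (p i) (if b i then σ i else σ' i) = |p i| ∧
            signed (p i) (if b i then σ' i else σ i) = -|p i|) := by
        by_cases hB : b i <;> simp only [hB, if_true, if_false] <;> simp only [b] at hB <;> grind
      rcases hor with ⟨h1, h2, h3⟩ | ⟨h1, h2, h3⟩ <;> rw [h2, h3, h1] <;> grind
    have hU := hsum (Finset.univ.filter fun i => σ i ≠ σ' i ∧ -|p i| < t ∧ t ≤ |p i|)
      (fun i hi => by simp only [Finset.mem_filter, Finset.mem_univ, true_and] at hi ⊢; exact hi.1)
      (fun i hi j hj hij => by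
        simp only [Finset.mem_filter, Finset.mem_univ, true_and] at hi hj hij ⊢
        exact ⟨hj, by linarith, by linarith⟩)
    rw [Finset.sum_filter, ← Finset.sum_congr rfl fun i _ => hterm i,
      Finset.sum_sub_distrib] at hU
    rw [below_points, below_points, abs_le]
    have hx : ((if x₀ < t then 1 else 0) + (if x₂ < t then 1 else 0)
        - ((if x₁ < t then 1 else 0) + (if x₃ < t then 1 else 0)) : ℤ) = 0 ∨
        ((if x₀ < t then 1 else 0) + (if x₂ < t then 1 else 0)
        - ((if x₁ < t then 1 else 0) + (if x₃ < t then 1 else 0)) : ℤ) = -1 := by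
      by_cases t0 : x₀ < t
      · simp [t0, h₁₀.trans_lt t0, (h₂₁.trans h₁₀).trans_lt t0,
          (h₃₂.trans (h₂₁.trans h₁₀)).trans_lt t0]
      · by_cases t1 : x₁ < t
        · simp [t0, t1, h₂₁.trans_lt t1, (h₃₂.trans h₂₁).trans_lt t1]
        · by_cases t2 : x₂ < t
          · simp [t0, t1, t2, h₃₂.trans_lt t2]
          · by_cases t3 : x₃ < t <;> simp [t0, t1, t2, t3]
    omega

/-- Every pair of sign vectors can be balanced with one of the two other divisions of the additional
points. A colouring opposite on the two entries of each row, on `x₀, x₂` and on `x₁, x₃` does so;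
the colour of `x₁` decides which division it gives. -/
lemma exists_exchange_coloring {N : ℕ} (p : Fin N → ℝ) (x₀ x₁ x₂ x₃ : ℝ)
    (σ σ' : Fin N → Bool) :
    ∃ τ τ' : Fin N → Bool, IsExchange σ σ' τ τ' ∧
      ((∀ t, |below (points p τ x₀ x₁) t - below (points p τ' x₂ x₃) t| ≤ 1) ∨
        ∀ t, |below (points p τ x₀ x₃) t - below (points p τ' x₁ x₂) t| ≤ 1) := by
  let v : (Fin N × Bool) ⊕ Fin 4 → ℝ :=
    Sum.elim (fun x => signed (p x.1) (if x.2 then σ x.1 else σ' x.1)) ![x₀, x₁, x₂, x₃]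
  let d : Equiv.Perm ((Fin N × Bool) ⊕ Fin 4) :=
    Equiv.sumCongr (Equiv.prodCongr (Equiv.refl _) Equiv.boolNot) (Equiv.addRight 2)
  have h4 : ∀ k : Fin 4, k + 2 + 2 = k := by decide
  obtain ⟨w, hw, hwd, hw0, hbal⟩ := exists_balanced_coloring v d
    (by rintro (⟨i, b⟩ | k) <;> simp [d, h4])
    (by rintro (⟨i, b⟩ | k) <;> simp [d])
    (by simp only [Fintype.card_sum, Fintype.card_prod, Fintype.card_bool, Fintype.card_fin]
        exact ⟨N + 2, by ring⟩) (Sum.inr 0)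
  have hwf : ∀ i, w (Sum.inl (i, false)) = -w (Sum.inl (i, true)) := fun i => by
    simpa [d] using hwd (Sum.inl (i, true))
  have hw2 : w (Sum.inr 2) = -1 := by
    have := hwd (Sum.inr 0)
    rw [hw0] at this
    simpa [d] using this
  have hw3 : w (Sum.inr 3) = -w (Sum.inr 1) := hwd (Sum.inr 1)
  let τ : Fin N → Bool := fun i => if w (Sum.inl (i, true)) = 1 then σ i else σ' i
  let τ' : Fin N → Bool := fun i => if w (Sum.inl (i, true)) = 1 then σ' i else σ i
  have hrow : ∀ t i, ((if signed (p i) (τ i) < t then 1 else 0)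
      - (if signed (p i) (τ' i) < t then 1 else 0) : ℤ)
      = (if signed (p i) (σ i) < t then w (Sum.inl (i, true)) else 0)
        + (if signed (p i) (σ' i) < t then w (Sum.inl (i, false)) else 0) := by
    intro t i
    rw [hwf]
    rcases hw (Sum.inl (i, true)) with h | h <;> simp only [τ, τ', h] <;>
      by_cases h1 : signed (p i) (σ i) < t <;> by_cases h2 : signed (p i) (σ' i) < t <;>
      simp [h1, h2]
  have hsum : ∀ t, (∑ x, if v x < t then w x else 0)
      = (∑ i, if signed (p i) (τ i) < t then 1 else 0)
        - (∑ i, if signed (p i) (τ' i) < t then 1 else 0)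
        + ((if x₀ < t then 1 else 0) + (if x₁ < t then w (Sum.inr 1) else 0)
        + (if x₂ < t then -1 else 0) + (if x₃ < t then -w (Sum.inr 1) else 0)) := by
    intro t
    rw [← Finset.sum_sub_distrib, Finset.sum_congr rfl fun i _ => hrow t i]
    simp [v, Fintype.sum_sum_type, Fintype.sum_prod_type, Fin.sum_univ_four, hw0, hw2, hw3]
    rfl
  refine ⟨τ, τ', fun i => ?_, ?_⟩
  · by_cases h : w (Sum.inl (i, true)) = 1 <;> simp [τ, τ', h]
  · rcases hw (Sum.inr 1) with h | h
    · left
      intro t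
      have := hbal t
      rw [hsum, h] at this
      rw [below_points, below_points]
      convert this using 2
      split_ifs <;> ring
    · right
      intro t
      have := hbal t
      rw [hsum, h] at this
      rw [below_points, below_points]
      convert this using 2
      split_ifs <;> ring

/-- The three-term (tropical Plücker) relation with its distinguished term on the left. -/
theorem pairMax_three_term {N : ℕ} (p : Fin N → ℝ) (θ : Fin N → Bool → ℝ) {x₀ x₁ x₂ x₃ : ℝ}
    (h₁₀ : x₁ ≤ x₀) (h₂₁ : x₂ ≤ x₁) (h₃₂ : x₃ ≤ x₂) :
    pairMax p θ x₀ x₂ + pairMax p θ x₁ x₃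
      = max (pairMax p θ x₀ x₁ + pairMax p θ x₂ x₃)
        (pairMax p θ x₀ x₃ + pairMax p θ x₁ x₂) := by
  apply le_antisymm
  · refine pairMax_add_le p θ fun σ σ' => ?_
    obtain ⟨τ, τ', hex, h | h⟩ := exists_exchange_coloring p x₀ x₁ x₂ x₃ σ σ'
    · exact ⟨x₀, x₁, x₂, x₃, τ, τ', hex, le_max_left _ _, fun t => by ring, h⟩
    · exact ⟨x₀, x₃, x₁, x₂, τ, τ', hex, le_max_right _ _, fun t => by ring, h⟩
  · refine max_le (pairMax_add_le p θ fun σ σ' => ?_) (pairMax_add_le p θ fun σ σ' => ?_) <;>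
    · obtain ⟨τ, τ', hex, h⟩ := exists_exchange_alternating p h₁₀ h₂₁ h₃₂ σ σ'
      exact ⟨x₀, x₂, x₁, x₃, τ, τ', hex, le_rfl, fun t => by ring, h⟩

end UltradiscreteKP

/-! ### The ultradiscrete KP equation -/

theorem theorem3 (N : ℕ) (a₁ a₂ a₃ : ℝ) (h₁₂ : a₂ < a₁) (h₂₃ : a₃ < a₂)
    (p c c' : Fin N → ℝ) (s : ℝ) :
    UltradiscreteKP.SatisfiesUKP a₁ a₂ (UltradiscreteKP.tau a₁ a₂ a₃ p c c' s) := by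
  open UltradiscreteKP in
  intro l m n
  simp only [tau_eq_signMax]
  set θ : Fin N → Bool → ℝ := fun i => phase a₁ a₂ a₃ (p i) (c i) (c' i) l m n s with hθ
  -- A point `a₀` above all others adds only constants, and turns single shifts into pairs.
  obtain ⟨a₀, h₀, hp⟩ : ∃ a₀, a₁ ≤ a₀ ∧ ∀ i b, signed (p i) b ≤ a₀ := by
    refine ⟨|a₁| + ∑ i, |p i|, ?_, fun i b => ?_⟩
    · exact (le_abs_self a₁).trans
        (le_add_of_nonneg_right (Finset.sum_nonneg fun i _ => abs_nonneg _))
    · have h1 : |p i| ≤ ∑ i, |p i| :=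
        Finset.single_le_sum (f := fun i => |p i|) (fun i _ => abs_nonneg _) (Finset.mem_univ i)
      have h2 : signed (p i) b ≤ |p i| := by
        cases b
        · exact neg_le_abs (p i)
        · exact le_abs_self (p i)
      linarith [abs_nonneg a₁]
  have hmax : ∀ x a : ℝ, max 0 (x - a) = max x a - a := fun x a => by
    rw [← max_sub_sub_right, sub_self, max_comm]
  have e := pairMax_three_term p θ h₀ h₁₂.le h₂₃.le
  rw [pairMax_eq_signMax p (α := a₀) (β := a₂)
      (θ' := fun i => phase a₁ a₂ a₃ (p i) (c i) (c' i) l (m + 1) n s),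
    pairMax_eq_signMax p (α := a₁) (β := a₃)
      (θ' := fun i => phase a₁ a₂ a₃ (p i) (c i) (c' i) (l + 1) m (n + 1) s),
    pairMax_eq_signMax p (α := a₀) (β := a₁)
      (θ' := fun i => phase a₁ a₂ a₃ (p i) (c i) (c' i) (l + 1) m n s),
    pairMax_eq_signMax p (α := a₂) (β := a₃)
      (θ' := fun i => phase a₁ a₂ a₃ (p i) (c i) (c' i) l (m + 1) (n + 1) s),
    pairMax_eq_signMax p (α := a₀) (β := a₃)
      (θ' := fun i => phase a₁ a₂ a₃ (p i) (c i) (c' i) l m (n + 1) s),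
    pairMax_eq_signMax p (α := a₁) (β := a₂)
      (θ' := fun i => phase a₁ a₂ a₃ (p i) (c i) (c' i) (l + 1) (m + 1) n s)] at e
  · set C := signMax p fun i => phase a₁ a₂ a₃ (p i) (c i) (c' i) (l + 1) m n s
    set D := signMax p fun i => phase a₁ a₂ a₃ (p i) (c i) (c' i) l (m + 1) (n + 1) s
    set E := signMax p fun i => phase a₁ a₂ a₃ (p i) (c i) (c' i) l m (n + 1) s
    set F := signMax p fun i => phase a₁ a₂ a₃ (p i) (c i) (c' i) (l + 1) (m + 1) n s
    rw [max_eq_left (h₁₂.le.trans h₀), max_eq_left (h₂₃.trans h₁₂).le, max_eq_left h₀,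
      max_eq_left h₂₃.le, max_eq_left ((h₂₃.trans h₁₂).le.trans h₀), max_eq_left h₁₂.le] at e
    rcases le_total (C + D - a₁) (E + F - a₂) with h | h
    · rw [max_eq_right h]
      rw [max_eq_right (by linarith)] at e
      linarith
    · rw [max_eq_left h]
      rw [max_eq_left (by linarith)] at e
      linarith
  all_goals
    intro i b
    have h0 : max (signed (p i) b) a₀ = a₀ := max_eq_right (hp i b)
    simp only [h0, hθ]
    cases b <;> simp only [phase, signed, eta, eta', hmax, if_true, Bool.false_eq_true, if_false] <;>
      ring
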